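/- Let $G$ be a compact Lie group, $K$ a closed subgroup, and let $G/K$ (left cosets, quotient topology) carry its standard smooth structure, for which the projection $G\to G/K$ is a smooth submersion. For a compact manifold $X$ let $\mathcal D(X)$ be the space of complex-valued $C^\infty$ functions on $X$ (all are compactly supported); for a Banach algebra $\mathcal B\subseteq C(X)$ (pointwise operations, with its own norm) and $E\subseteq X$ closed, call $E$ a set of smooth synthesis for $\mathcal B$ if the closure in $\mathcal B$ of $\{f\in\mathcal D(X)\cap\mathcal B : f|_E=0\}$ equals $\{f\in\mathcal B : f|_E=0\}$. Let $\mathcal A(G)\subseteq C(G)$ be a Banach algebra of continuous functions on $G$ that is regular on $G$ (for every closed $S\subseteq G$ and $x\notin S$ some $f\in\mathcal A(G)$ has $f(x)=1$ and $f|_S=0$), is closed under the right translations $(R_sf)(y)=f(ys)$, $s\in G$, and satisfies, for every $f\in\mathcal A(G)$: $\|R_sf\|_{\mathcal A}=\|f\|_{\mathcal A}$ for all $s\in G$, and $s\mapsto R_sf$ is continuous from $G$ to $\mathcal A(G)$. Assume moreover that $\mathcal T(G)\mathcal A(G)\subseteq\mathcal A(G)$, where $\mathcal T(G)$ is the space of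 trigonometric polynomials on $G$ (the linear span of the matrix coefficients of continuous finite-dimensional unitary representations of $G$), and that $\mathcal D(G)\subseteq\mathcal A(G)$. Let $\mathcal A(G:K)=\{f\in\mathcal A(G) : R_kf=f \text{ for all } k\in K\}$, and let $\mathcal A(G/K)\subseteq C(G/K)$ be the algebra of the functions $Mf$, $Mf(sK)=f(s)$, with $f\in\mathcal A(G:K)$, normed by $\|Mf\|=\|f\|_{\mathcal A}$. Let $E\subseteq G/K$ be closed and $E^*=\{s\in G : sK\in E\}$. Then $E$ is a set of smooth synthesis for $\mathcal A(G/K)$ if and only if $E^*$ is a set of smooth synthesis for $\mathcal A(G)$. -/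

import Mathlib

open scoped Manifold ContDiff Topology

noncomputable section

namespace SmoothSynthesis

/-! A Banach algebra `A` contained in `C(X)`, whose norm is in general not the supremum norm, is
given by a commutative complex Banach algebra `A` with an injective homomorphism
`ι : A → C(X, ℂ)`, its inclusion. -/

section General

variable {A : Type*} [NonUnitalNormedCommRing A] [NormedSpace ℂ A]
  {X : Type*} [TopologicalSpace X]

/-- `A` is regular on `X`: it separates points from closed sets. -/
def IsRegularOn (ι : A →ₙₐ[ℂ] C(X, ℂ)) : Prop :=
  ∀ S : Set X, IsClosed S → ∀ x ∉ S, ∃ a : A, ι a x = 1 ∧ ∀ y ∈ S, ι a y = 0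

/-- `I_A(E)`, the elements of `A` that vanish on `E`. -/
def vanishing (ι : A →ₙₐ[ℂ] C(X, ℂ)) (E : Set X) : Set A :=
  {a | ∀ x ∈ E, ι a x = 0}

variable {V : Type*} [NormedAddCommGroup V] [NormedSpace ℝ V] [ChartedSpace V X]

variable (X V) in
/-- `D(X)`, the compactly supported complex-valued `C^∞` functions on the manifold `X`, which is
modelled on the real vector space `V`. -/
def testFunctions : Set C(X, ℂ) :=
  {f | ContMDiff 𝓘(ℝ, V) 𝓘(ℝ, ℂ) ∞ f ∧ HasCompactSupport f}

variable (V) in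
/-- `J^D_A(E)`, the closure, in the norm of `A`, of the elements of `D(X) ∩ A` that
vanish on `E`. -/
def smoothVanishing (ι : A →ₙₐ[ℂ] C(X, ℂ)) (E : Set X) : Set A :=
  closure {a | ι a ∈ testFunctions X V ∧ ∀ x ∈ E, ι a x = 0}

variable (V) in
/-- `E` is a set of smooth synthesis for `A`. -/
def IsSmoothSynthesis (ι : A →ₙₐ[ℂ] C(X, ℂ)) (E : Set X) : Prop :=
  smoothVanishing V ι E = vanishing ι E

end General

section Group

variable {A : Type*} [NonUnitalNormedCommRing A] [NormedSpace ℂ A]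
  {G : Type*} [Group G] [TopologicalSpace G]

/-- `b = R_s a`, where `(R_s f)(y) = f(ys)`. -/
def IsRightTranslate (ι : A →ₙₐ[ℂ] C(G, ℂ)) (s : G) (a b : A) : Prop :=
  ∀ y, ι b y = ι a (y * s)

/-- `A` is closed under right translations, these are isometric, and `s ↦ R_s f` is a continuous
map from `G` to `A` for each `f` in `A`. -/
structure IsRightInvariant (ι : A →ₙₐ[ℂ] C(G, ℂ)) : Prop where
  exists_translate : ∀ (s : G) (a : A), ∃ b : A, IsRightTranslate ι s a b
  norm_translate : ∀ (s : G) (a b : A), IsRightTranslate ι s a b → ‖b‖ = ‖a‖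
  continuous_translate : ∀ (a : A) (T : G → A),
    (∀ s, IsRightTranslate ι s a (T s)) → Continuous T

variable (G) in
/-- `T(G)`, the trigonometric polynomials on `G`: the linear span of the matrix coefficients of
the continuous finite-dimensional unitary representations of `G`. -/
def trigPolynomials : Submodule ℂ C(G, ℂ) :=
  Submodule.span ℂ {u | ∃ (n : ℕ) (σ : G →* Matrix.unitaryGroup (Fin n) ℂ) (i j : Fin n),
    Continuous σ ∧ ∀ s, u s = (σ s : Matrix (Fin n) (Fin n) ℂ) i j}

/-- `A(G:K)`, the subalgebra, with the norm of `A`, of the `f` in `A` with `R_k f = f` for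
all `k` in `K`. -/
def invariants (ι : A →ₙₐ[ℂ] C(G, ℂ)) (K : Subgroup G) : NonUnitalSubalgebra ℂ A where
  carrier := {a | ∀ k ∈ K, IsRightTranslate ι k a a}
  add_mem' {a b} ha hb k hk y := by
    have h1 := ha k hk y
    have h2 := hb k hk y
    simp [h1.symm, h2.symm]
  zero_mem' k hk y := by simp
  mul_mem' {a b} ha hb k hk y := by
    have h1 := ha k hk y
    have h2 := hb k hk y
    simp [h1.symm, h2.symm]
  smul_mem' c a ha k hk y := by
    have h1 := ha k hk y
    simp [h1.symm]

instance invariantsNormedSpace (ι : A →ₙₐ[ℂ] C(G, ℂ)) (K : Subgroup G) : NormedSpace ℂ (invariants ι K) where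
  norm_smul_le c a := norm_smul_le c (a : A)

/-- The homomorphism `M : A(G:K) → C(G/K)`, `(M f)(sK) = f(s)`. The algebra `A(G/K)` is the range
of `M` with the norm that makes `M` an isometry; so `A(G/K)` is the Banach algebra `A(G:K)` with
`M` as its inclusion into `C(G/K)`. -/
def cosetInclusion (ι : A →ₙₐ[ℂ] C(G, ℂ)) (K : Subgroup G) :
    invariants ι K →ₙₐ[ℂ] C(G ⧸ K, ℂ) where
  toFun a :=
    { toFun := Quotient.lift (fun s => ι (a : A) s) (by
        intro s t hst
        have h := a.2 _ (QuotientGroup.leftRel_apply.1 hst) s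
        simpa using h)
      continuous_toFun := (ι (a : A)).continuous.quotient_lift _ }
  map_smul' c a := by
    ext x
    induction x using QuotientGroup.induction_on with
    | H s => exact congrArg (fun f : C(G, ℂ) => f s) (map_smul ι c (a : A))
  map_zero' := by
    ext x
    induction x using QuotientGroup.induction_on with
    | H s => exact congrArg (fun f : C(G, ℂ) => f s) (map_zero ι)
  map_add' a b := by
    ext x
    induction x using QuotientGroup.induction_on with
    | H s => exact congrArg (fun f : C(G, ℂ) => f s) (map_add ι (a : A) (b : A))
  map_mul' a b := by
    ext x
    induction x using QuotientGroup.induction_on with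
    | H s => exact congrArg (fun f : C(G, ℂ) => f s) (map_mul ι (a : A) (b : A))

theorem cosetInclusion_mk (ι : A →ₙₐ[ℂ] C(G, ℂ)) (K : Subgroup G) (a : invariants ι K) (s : G) :
    cosetInclusion ι K a (QuotientGroup.mk s) = ι (a : A) s :=
  rfl

theorem cosetInclusion_injective (ι : A →ₙₐ[ℂ] C(G, ℂ)) (hι : Function.Injective ι)
    (K : Subgroup G) : Function.Injective (cosetInclusion ι K) := by
  intro a b hab
  refine Subtype.ext (hι (ContinuousMap.ext fun s => ?_))
  rw [← cosetInclusion_mk, hab, cosetInclusion_mk]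

end Group

end SmoothSynthesis

end

/-! Both directions rest on averaging over `K` with its normalised Haar measure. The operator `P a =
∫_K R_k a dk` is a bounded projection of `A(G)` onto `A(G:K)`. It preserves smoothness and vanishing
on `E*`, and a smooth right `K`-invariant function descends to a smooth function on `G/K`, because a
submersion has smooth local sections. Applying `P` to an approximation in `A(G)` therefore gives one
in `A(G/K)`.

For the converse let `a` vanish on `E*`, let `J` be the closure of the smooth elements vanishing
there, and put `W(w) = ∫_K w(k) R_k a dk` for `w ∈ C(G)`. If `u(s⁻¹t) = ∑ φ_l(s) ψ_l(t)` with `φ_l`,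
`ψ_l` smooth, then writing `k = s⁻¹(sk)` gives `W(u) = ∑ φ_l P(ψ_l a)` (`weightedAverage_eq_sum`).
Each `P(ψ_l a)` lies in `A(G:K)` and vanishes on `E*`, so synthesis on `G/K` approximates it, and
multiplication by the smooth `φ_l` stays in `J`. By Peter–Weyl (`eq_top_of_isSmoothLeftFinite_mem`)
such `u` are dense in `C(G)`, so `W(w) ∈ J` for every `w`. Weights concentrating at `1` recover `a`
(`mem_of_forall_integral_bump_mem`).

Peter–Weyl comes from the spectral theorem for convolution by a smooth symmetric bump, a compact
self-adjoint operator on `L²(G)` that commutes with left translations. -/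

noncomputable section

namespace SmoothSynthesis
open MeasureTheory Set Filter

/-! ### Smooth dependence of integrals on a parameter -/

section Parametric

variable {E : Type*} [NormedAddCommGroup E] [NormedSpace ℝ E]
  {M : Type*} [TopologicalSpace M] [ChartedSpace E M] [IsManifold 𝓘(ℝ, E) ∞ M]

/-- The partial derivative of a smooth function of `(x, y)` in the vector variable `x` is a smooth
function of `(x, y)`. -/
theorem contMDiffOn_partial_fderiv {U : Set E} (hU : IsOpen U) {H : E × M → ℂ}
    (hH : ContMDiffOn (𝓘(ℝ, E).prod 𝓘(ℝ, E)) 𝓘(ℝ, ℂ) ∞ H (U ×ˢ univ)) :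
    ContMDiffOn (𝓘(ℝ, E).prod 𝓘(ℝ, E)) 𝓘(ℝ, E →L[ℝ] ℂ) ∞
      (fun p : E × M => fderiv ℝ (fun x => H (x, p.2)) p.1) (U ×ˢ univ) := by
  intro p hp
  have hopen : IsOpen (U ×ˢ (univ : Set M)) := hU.prod isOpen_univ
  have hHp : ContMDiffAt (𝓘(ℝ, E).prod 𝓘(ℝ, E)) 𝓘(ℝ, ℂ) ∞ H p :=
    hH.contMDiffAt (hopen.mem_nhds hp)
  have h1 : ContMDiffAt ((𝓘(ℝ, E).prod 𝓘(ℝ, E)).prod 𝓘(ℝ, E)) 𝓘(ℝ, ℂ) ∞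
      (Function.uncurry fun (q : E × M) (x : E) => H (x, q.2)) (p, p.1) := by
    have h2 : ContMDiffAt ((𝓘(ℝ, E).prod 𝓘(ℝ, E)).prod 𝓘(ℝ, E)) (𝓘(ℝ, E).prod 𝓘(ℝ, E)) ∞
        (fun r : (E × M) × E => (r.2, r.1.2)) (p, p.1) :=
      contMDiffAt_snd.prodMk (contMDiffAt_snd.comp (p, p.1) contMDiffAt_fst)
    exact ContMDiffAt.comp_of_eq (g := H) (y := p) hHp h2 rfl
  have h3 := ContMDiffAt.mfderiv (m := ∞) (fun (q : E × M) (x : E) => H (x, q.2)) Prod.fst h1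
    contMDiffAt_fst (by simp)
  -- Over a vector space the tangent bundle is trivial, so the derivative read in tangent
  -- coordinates is the ordinary `fderiv`.
  have h4 := inTangentCoordinates_model_space (I := 𝓘(ℝ, E)) (I' := 𝓘(ℝ, ℂ))
    (Prod.fst : E × M → E) (fun q => H (q.1, q.2))
    (fun q => fderiv ℝ (fun x => H (x, q.2)) q.1) p
  simp only [mfderiv_eq_fderiv] at h3
  replace h3 := h3.congr_of_eventuallyEq (Filter.EventuallyEq.of_eq h4.symm)
  exact h3.contMDiffWithinAt

variable {Y : Type*} [TopologicalSpace Y] [CompactSpace Y] [MeasurableSpace Y] [BorelSpace Y]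
  (μ : Measure Y) [IsFiniteMeasure μ]

theorem _root_.Continuous.integrable_of_compactSpace {W : Type*} [NormedAddCommGroup W] {f : Y → W}
    (hf : Continuous f) : Integrable f μ :=
  hf.integrable_of_hasCompactSupport (HasCompactSupport.of_compactSpace _)

theorem _root_.ContinuousOn.continuous_slice {X M Y W : Type*} [TopologicalSpace X]
    [TopologicalSpace M] [TopologicalSpace Y] [TopologicalSpace W] {U : Set X} {H : X × M → W}
    (hH : ContinuousOn H (U ×ˢ univ)) {j : Y → M} (hj : Continuous j) {x : X} (hx : x ∈ U) :
    Continuous fun y => H (x, j y) :=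
  hH.comp_continuous (by fun_prop) fun _ => ⟨hx, mem_univ _⟩

/-- A directional derivative of the integral is an integral of the same form, with `H` replaced by
its partial derivative. Hence the induction on `n` keeps `H` arbitrary. -/
theorem contDiffOn_integral_of_contMDiffOn [FiniteDimensional ℝ E] {U : Set E} (hU : IsOpen U)
    {j : Y → M} (hj : Continuous j) {g : Y → ℂ} (hg : Continuous g) (n : ℕ) :
    ∀ {H : E × M → ℂ}, ContMDiffOn (𝓘(ℝ, E).prod 𝓘(ℝ, E)) 𝓘(ℝ, ℂ) ∞ H (U ×ˢ univ) →
      ContDiffOn ℝ n (fun x => ∫ y, g y * H (x, j y) ∂μ) U := by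
  have key : ∀ {H : E × M → ℂ}, ContMDiffOn (𝓘(ℝ, E).prod 𝓘(ℝ, E)) 𝓘(ℝ, ℂ) ∞ H (U ×ˢ univ) →
      ∀ x₀ ∈ U, HasFDerivAt (fun x => ∫ y, g y * H (x, j y) ∂μ)
        (∫ y, g y • fderiv ℝ (fun x => H (x, j y)) x₀ ∂μ) x₀ := by
    intro H hH x₀ hx₀
    have hD := (contMDiffOn_partial_fderiv hU hH).continuousOn
    set D : E × M → (E →L[ℝ] ℂ) := fun p => fderiv ℝ (fun x => H (x, p.2)) p.1 with hDdef
    have hb : ∃ C : ℝ, ∀ᶠ x in 𝓝 x₀, ∀ y, ‖g y • D (x, j y)‖ ≤ C := by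
      have hc : ContinuousOn (fun q : E × Y => ‖g q.2 • D (q.1, j q.2)‖) (U ×ˢ univ) := by
        refine ((hg.comp continuous_snd).continuousOn.smul (hD.comp (t := U ×ˢ univ) ?_ ?_)).norm
        · fun_prop
        · exact fun q hq => ⟨hq.1, mem_univ _⟩
      obtain ⟨C, hC⟩ := (isCompact_univ (X := Y)).bddAbove_image
        (f := fun y => ‖g y • D (x₀, j y)‖)
        (((hg.smul (hD.continuous_slice hj hx₀)).norm).continuousOn)
      -- The slack `1` makes the bound at `x₀` strict, hence open in `(x, y)`. Compactness of `Y`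
      -- then gives one neighbourhood of `x₀` that serves all `y`.
      refine ⟨C + 1, ?_⟩
      have h1 : ∀ y ∈ (univ : Set Y), ∀ᶠ q : E × Y in 𝓝 (x₀, y),
          ‖g q.2 • D (q.1, j q.2)‖ ≤ C + 1 := by
        intro y _
        have h2 : ContinuousAt (fun q : E × Y => ‖g q.2 • D (q.1, j q.2)‖) (x₀, y) :=
          hc.continuousAt ((hU.prod isOpen_univ).mem_nhds ⟨hx₀, mem_univ _⟩)
        have h3 : ‖g y • D (x₀, j y)‖ < C + 1 :=
          lt_of_le_of_lt (hC ⟨y, mem_univ _, rfl⟩) (lt_add_one C)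
        exact (h2.eventually (gt_mem_nhds h3)).mono fun q hq => le_of_lt hq
      have h4 := isCompact_univ.eventually_forall_of_forall_eventually (x₀ := x₀)
        (P := fun x y => ‖g y • D (x, j y)‖ ≤ C + 1) h1
      exact h4.mono fun x hx y => hx y (mem_univ _)
    obtain ⟨C, hC⟩ := hb
    have hs := hC.and (hU.mem_nhds hx₀)
    refine hasFDerivAt_integral_of_dominated_of_fderiv_le
      (F := fun x y => g y * H (x, j y)) (F' := fun x y => g y • D (x, j y))
      (bound := fun _ => C) hs ?_ ?_ ?_ ?_ (integrable_const C) ?_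
    · filter_upwards [hU.mem_nhds hx₀] with x hx
      exact ((hg.mul (hH.continuousOn.continuous_slice hj hx)).integrable_of_compactSpace μ).aestronglyMeasurable
    · exact (hg.mul (hH.continuousOn.continuous_slice hj hx₀)).integrable_of_compactSpace μ
    · exact ((hg.smul (hD.continuous_slice hj hx₀)).integrable_of_compactSpace μ).aestronglyMeasurable
    · exact Eventually.of_forall fun y x hx => hx.1 y
    · refine Eventually.of_forall fun y x hx => ?_
      have h5 : DifferentiableAt ℝ (fun x => H (x, j y)) x := by
        have h6 : ContMDiffAt 𝓘(ℝ, E) 𝓘(ℝ, ℂ) ∞ (fun x => H (x, j y)) x := by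
          have h7 : ContMDiffAt (𝓘(ℝ, E).prod 𝓘(ℝ, E)) 𝓘(ℝ, ℂ) ∞ H (x, j y) :=
            hH.contMDiffAt ((hU.prod isOpen_univ).mem_nhds ⟨hx.2, mem_univ _⟩)
          exact h7.comp x (contMDiffAt_id.prodMk contMDiffAt_const)
        exact h6.contDiffAt.differentiableAt (by simp)
      exact h5.hasFDerivAt.const_mul (g y)
  induction n with
  | zero =>
    intro H hH
    exact contDiffOn_zero.2 fun x hx => (key hH x hx).continuousAt.continuousWithinAt
  | succ n ih =>
    intro H hH
    have hcast : ((n + 1 : ℕ) : WithTop ℕ∞) = (n : WithTop ℕ∞) + 1 := by push_cast; rfl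
    rw [hcast, contDiffOn_succ_iff_fderiv_apply hU.uniqueDiffOn]
    refine ⟨fun x hx => (key hH x hx).differentiableAt.differentiableWithinAt, by simp, ?_⟩
    intro v
    have hDs := contMDiffOn_partial_fderiv hU hH
    have hv : ContMDiffOn (𝓘(ℝ, E).prod 𝓘(ℝ, E)) 𝓘(ℝ, ℂ) ∞
        (fun p : E × M => fderiv ℝ (fun x => H (x, p.2)) p.1 v) (U ×ˢ univ) :=
      hDs.clm_apply contMDiffOn_const
    refine (ih hv).congr fun x hx => ?_
    rw [fderivWithin_of_isOpen hU hx, (key hH x hx).fderiv]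
    rw [ContinuousLinearMap.integral_apply]
    · simp
    · exact (hg.smul (hDs.continuousOn.continuous_slice hj hx)).integrable_of_compactSpace μ

/-- Differentiation under the integral sign: integrating out one variable of a smooth function of
two variables against a finite measure on a compact space yields a smooth function. -/
theorem contMDiff_integral [FiniteDimensional ℝ E] {N : Type*} [TopologicalSpace N]
    [ChartedSpace E N] [IsManifold 𝓘(ℝ, E) ∞ N]
    {H : N × M → ℂ} (hH : ContMDiff (𝓘(ℝ, E).prod 𝓘(ℝ, E)) 𝓘(ℝ, ℂ) ∞ H)
    {j : Y → M} (hj : Continuous j) {g : Y → ℂ} (hg : Continuous g) :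
    ContMDiff 𝓘(ℝ, E) 𝓘(ℝ, ℂ) ∞ fun s => ∫ y, g y * H (s, j y) ∂μ := by
  intro s₀
  set c := chartAt E s₀
  have h1 : ContMDiffOn (𝓘(ℝ, E).prod 𝓘(ℝ, E)) 𝓘(ℝ, ℂ) ∞
      (fun p : E × M => H (c.symm p.1, p.2)) (c.target ×ˢ univ) := by
    refine hH.comp_contMDiffOn (ContMDiffOn.prodMk ?_ contMDiffOn_snd)
    exact (contMDiffOn_chart_symm (I := 𝓘(ℝ, E)) (x := s₀)).comp contMDiffOn_fst fun p hp => hp.1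
  have h2 : ContDiffOn ℝ ∞ (fun x => ∫ y, g y * H (c.symm x, j y) ∂μ) c.target :=
    contDiffOn_infty.2 fun n => contDiffOn_integral_of_contMDiffOn μ c.open_target hj hg n h1
  have h3 : ContMDiffOn 𝓘(ℝ, E) 𝓘(ℝ, ℂ) ∞ (fun s => ∫ y, g y * H (c.symm (c s), j y) ∂μ)
      c.source :=
    (contMDiffOn_iff_contDiffOn.2 h2).comp (contMDiffOn_chart (I := 𝓘(ℝ, E)) (x := s₀))
      fun s hs => c.map_source hs
  have h4 : c.source ∈ 𝓝 s₀ := c.open_source.mem_nhds (mem_chart_source E s₀)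
  refine (h3.contMDiffAt h4).congr_of_eventuallyEq ?_
  filter_upwards [h4] with s hs
  rw [c.left_inv hs]

end Parametric

/-! ### Compactness of operators with continuous kernel -/

section KernelOperator

variable {X : Type*} [TopologicalSpace X] [CompactSpace X]
  {W : Type*} [NormedAddCommGroup W] [InnerProductSpace ℂ W]

/-- The operator `v ↦ (x ↦ ⟪κ x, v⟫)` defined by a continuous family `κ` of vectors. -/
def kernelOp (κ : C(X, W)) : W →L[ℂ] C(X, ℂ) :=
  LinearMap.mkContinuous
    { toFun := fun v => ⟨fun x => inner ℂ (κ x) v, by fun_prop⟩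
      map_add' := fun v w => by ext x; simp
      map_smul' := fun c v => by ext x; simp }
    ‖κ‖ fun v => (ContinuousMap.norm_le _ (by positivity)).2 fun x =>
      (norm_inner_le_norm _ _).trans
        (mul_le_mul_of_nonneg_right (κ.norm_coe_le_norm x) (norm_nonneg v))

@[simp]
theorem kernelOp_apply (κ : C(X, W)) (v : W) (x : X) : kernelOp κ v x = inner ℂ (κ x) v := rfl

/-- By Cauchy–Schwarz the images of unit-ball vectors are bounded by `κ` and oscillate no more than
`κ`. Functions with these two bounds form an equicontinuous set that is pointwise compact by
Tychonoff, so Arzelà–Ascoli applies. -/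
theorem isCompactOperator_kernelOp (κ : C(X, W)) : IsCompactOperator (kernelOp κ) := by
  set S : Set C(X, ℂ) := {f | (∀ x, ‖f x‖ ≤ ‖κ x‖) ∧ ∀ x y, ‖f x - f y‖ ≤ ‖κ x - κ y‖} with hS
  refine ⟨S, ArzelaAscoli.isCompact_of_equicontinuous S ?_ ?_, ?_⟩
  · have himage : ContinuousMap.toFun '' S =
        (univ.pi fun x => Metric.closedBall (0 : ℂ) ‖κ x‖) ∩
          ⋂ x, ⋂ y, {f : X → ℂ | ‖f x - f y‖ ≤ ‖κ x - κ y‖} := by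
      ext f
      simp only [mem_image, mem_inter_iff, Set.mem_pi, mem_univ, mem_closedBall_zero_iff,
        forall_true_left, mem_iInter, mem_ofPred_eq]
      refine ⟨?_, fun hf => ⟨⟨f, ?_⟩, ⟨hf.1, hf.2⟩, rfl⟩⟩
      · rintro ⟨g, hg, rfl⟩
        exact ⟨hg.1, hg.2⟩
      · refine continuous_iff_continuousAt.2 fun x => tendsto_iff_norm_sub_tendsto_zero.2 ?_
        refine squeeze_zero (fun _ => norm_nonneg _) (fun y => hf.2 y x) ?_
        exact tendsto_iff_norm_sub_tendsto_zero.1 κ.continuous.continuousAt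
    rw [himage]
    refine (isCompact_univ_pi fun x => isCompact_closedBall _ _).inter_right ?_
    refine isClosed_iInter fun x => isClosed_iInter fun y => isClosed_le ?_ continuous_const
    exact ((continuous_apply x).sub (continuous_apply y)).norm
  · intro x
    rw [Metric.equicontinuousAt_iff_right]
    intro ε hε
    have h1 := (tendsto_iff_norm_sub_tendsto_zero.1 (κ.continuous.continuousAt (x := x))).eventually
      (gt_mem_nhds hε)
    filter_upwards [h1] with y hy f
    rw [dist_comm, dist_eq_norm]
    exact (f.2.2 y x).trans_lt hy
  · filter_upwards [Metric.closedBall_mem_nhds (0 : W) one_pos] with v hv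
    rw [mem_closedBall_zero_iff] at hv
    refine ⟨fun x => ?_, fun x y => ?_⟩
    · exact (norm_inner_le_norm _ _).trans (mul_le_of_le_one_right (norm_nonneg _) hv)
    · rw [kernelOp_apply, kernelOp_apply, ← inner_sub_left]
      exact (norm_inner_le_norm _ _).trans (mul_le_of_le_one_right (norm_nonneg _) hv)

end KernelOperator

/-! ### Recovering a value from concentrating averages -/

section Peak

variable {Y : Type*} [TopologicalSpace Y] [CompactSpace Y] [MeasurableSpace Y] [BorelSpace Y]
  (μ : Measure Y) [IsFiniteMeasure μ] [μ.IsOpenPosMeasure]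
  {W : Type*} [NormedAddCommGroup W] [NormedSpace ℂ W] [CompleteSpace W]

/-- If the integrals of a continuous function against bump functions with arbitrarily small support
around a point lie in a closed subspace, then so does the value at the point. -/
theorem mem_of_forall_integral_bump_mem {Φ : Y → W} (hΦ : Continuous Φ) {C : Submodule ℂ W}
    (hC : IsClosed (C : Set W)) (y₀ : Y)
    (h : ∀ U ∈ 𝓝 y₀, ∃ b : C(Y, ℝ), (∀ y, 0 ≤ b y) ∧ 0 < b y₀ ∧ (∀ y ∉ U, b y = 0) ∧
      ∫ y, ((b y : ℝ) : ℂ) • Φ y ∂μ ∈ C) : Φ y₀ ∈ C := by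
  rw [← SetLike.mem_coe, ← hC.closure_eq, Metric.mem_closure_iff]
  intro ε hε
  have hU : {y | ‖Φ y - Φ y₀‖ < ε / 2} ∈ 𝓝 y₀ :=
    (tendsto_iff_norm_sub_tendsto_zero.1 (hΦ.continuousAt (x := y₀))).eventually
      (gt_mem_nhds (half_pos hε))
  obtain ⟨b, hb0, hb1, hbU, hbC⟩ := h _ hU
  have hc : 0 < ∫ y, b y ∂μ :=
    b.continuous.integral_pos_of_hasCompactSupport_nonneg_nonzero
      (HasCompactSupport.of_compactSpace _) hb0 hb1.ne'
  set c := ∫ y, b y ∂μ with hcdef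
  -- Divided by the mass `c` of the bump, the integral is a weighted mean of values of `Φ` within `ε
  -- / 2` of `Φ y₀`.
  refine ⟨((c⁻¹ : ℝ) : ℂ) • ∫ y, ((b y : ℝ) : ℂ) • Φ y ∂μ, C.smul_mem _ hbC, ?_⟩
  have hb : Continuous fun y => ((b y : ℝ) : ℂ) := by fun_prop
  have h1 : ∫ y, ((b y : ℝ) : ℂ) • (Φ y - Φ y₀) ∂μ =
      (∫ y, ((b y : ℝ) : ℂ) • Φ y ∂μ) - (c : ℂ) • Φ y₀ := by
    have i1 : Integrable (fun y => ((b y : ℝ) : ℂ) • Φ y) μ :=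
      (hb.smul hΦ).integrable_of_compactSpace μ
    have i2 : Integrable (fun y => ((b y : ℝ) : ℂ) • Φ y₀) μ :=
      (hb.smul continuous_const).integrable_of_compactSpace μ
    simp_rw [smul_sub]
    rw [integral_sub i1 i2, integral_smul_const, integral_complex_ofReal]
  have h2 : ‖∫ y, ((b y : ℝ) : ℂ) • (Φ y - Φ y₀) ∂μ‖ ≤ c * (ε / 2) := by
    rw [hcdef, ← integral_mul_const]
    refine norm_integral_le_of_norm_le
      ((b.continuous.mul continuous_const).integrable_of_compactSpace μ)
      (Eventually.of_forall fun y => ?_)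
    rw [norm_smul, Complex.norm_real, Real.norm_of_nonneg (hb0 y)]
    by_cases hy : ‖Φ y - Φ y₀‖ < ε / 2
    · exact mul_le_mul_of_nonneg_left hy.le (hb0 y)
    · simp [hbU y hy]
  have hcC : (c : ℂ) ≠ 0 := by exact_mod_cast hc.ne'
  have h3 : Φ y₀ - ((c⁻¹ : ℝ) : ℂ) • ∫ y, ((b y : ℝ) : ℂ) • Φ y ∂μ =
      -(((c⁻¹ : ℝ) : ℂ) • ∫ y, ((b y : ℝ) : ℂ) • (Φ y - Φ y₀) ∂μ) := by
    rw [h1, smul_sub, smul_smul]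
    push_cast
    rw [inv_mul_cancel₀ hcC, one_smul, neg_sub]
  rw [dist_eq_norm, h3, norm_neg, norm_smul, Complex.norm_real, Real.norm_of_nonneg (by positivity)]
  calc c⁻¹ * ‖∫ y, ((b y : ℝ) : ℂ) • (Φ y - Φ y₀) ∂μ‖ ≤ c⁻¹ * (c * (ε / 2)) := by gcongr
    _ = ε / 2 := by field_simp
    _ < ε := half_lt_self hε

end Peak

/-- The product of smooth complex-valued functions on a real manifold is smooth. -/
theorem contMDiff_mul_complex {E M : Type*} [NormedAddCommGroup E] [NormedSpace ℝ E]
    [TopologicalSpace M] [ChartedSpace E M] {f g : M → ℂ}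
    (hf : ContMDiff 𝓘(ℝ, E) 𝓘(ℝ, ℂ) ∞ f) (hg : ContMDiff 𝓘(ℝ, E) 𝓘(ℝ, ℂ) ∞ g) :
    ContMDiff 𝓘(ℝ, E) 𝓘(ℝ, ℂ) ∞ fun x => f x * g x :=
  (contDiff_mul (𝕜 := ℝ) (𝔸 := ℂ)).contMDiff.comp (hf.prodMk_space hg)

section LeftTranslate

variable {G : Type*} [Group G] [TopologicalSpace G] [IsTopologicalGroup G]

/-- `(L_s f)(t) = f(s⁻¹ t)`. -/
def leftTranslate (s : G) (f : C(G, ℂ)) : C(G, ℂ) := ⟨fun t => f (s⁻¹ * t), by fun_prop⟩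

@[simp]
theorem leftTranslate_apply (s : G) (f : C(G, ℂ)) (t : G) : leftTranslate s f t = f (s⁻¹ * t) := rfl

end LeftTranslate

/-! ### Convolution operators on `L²(G)` -/

section Convolution

variable {G : Type*} [Group G] [TopologicalSpace G] [IsTopologicalGroup G] [CompactSpace G]
  [MeasurableSpace G] [BorelSpace G] (μ : Measure G) [IsFiniteMeasure μ]

/-- The operator from `L²(G)` to `C(G)` with kernel `(x, y) ↦ conj (h (x⁻¹ y))`. -/
def convOp (h : C(G, ℂ)) : Lp ℂ 2 μ →L[ℂ] C(G, ℂ) :=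
  kernelOp
    ⟨fun x => ContinuousMap.toLp 2 μ ℂ
        (ContinuousMap.curry ⟨fun p : G × G => h (p.1⁻¹ * p.2), by fun_prop⟩ x),
      (ContinuousMap.toLp 2 μ ℂ).continuous.comp (ContinuousMap.continuous _)⟩

theorem isCompactOperator_toLp_comp_convOp (h : C(G, ℂ)) : IsCompactOperator
    ((ContinuousMap.toLp 2 μ ℂ).comp (convOp μ h) : Lp ℂ 2 μ →L[ℂ] Lp ℂ 2 μ) :=
  IsCompactOperator.clm_comp (f := convOp μ h) (isCompactOperator_kernelOp _)
    (ContinuousMap.toLp 2 μ ℂ)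

-- For Hermitian `h` the operator is right convolution `f ↦ f * h`, which explains why it commutes
-- with left translations.
variable {μ} in
theorem convOp_toLp {h : C(G, ℂ)} (hh : ∀ g, star (h g⁻¹) = h g) (f : C(G, ℂ)) (x : G) :
    convOp μ h (ContinuousMap.toLp 2 μ ℂ f) x = ∫ y, f y * h (y⁻¹ * x) ∂μ := by
  refine (ContinuousMap.inner_toLp μ _ _).trans (integral_congr_ae (Eventually.of_forall fun y => ?_))
  change f y * star (h (x⁻¹ * y)) = f y * h (y⁻¹ * x)
  rw [← hh (y⁻¹ * x)]
  simp

variable {μ} in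
theorem convOp_toLp_leftTranslate [μ.IsMulLeftInvariant] {h : C(G, ℂ)}
    (hh : ∀ g, star (h g⁻¹) = h g) (s : G) (f : C(G, ℂ)) :
    convOp μ h (ContinuousMap.toLp 2 μ ℂ (leftTranslate s f)) =
      leftTranslate s (convOp μ h (ContinuousMap.toLp 2 μ ℂ f)) := by
  ext x
  rw [leftTranslate_apply, convOp_toLp hh, convOp_toLp hh,
    ← integral_mul_left_eq_self (fun y => leftTranslate s f y * h (y⁻¹ * x)) s]
  simp [mul_assoc]

/-- By density of `C(G)` in `L²(G)` it suffices to take continuous functions, where this is Fubini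
together with the Hermitian symmetry of the kernel. -/
theorem isSymmetric_toLp_comp_convOp [μ.WeaklyRegular] {h : C(G, ℂ)}
    (hh : ∀ g, star (h g⁻¹) = h g) :
    ((ContinuousMap.toLp 2 μ ℂ).comp (convOp μ h) : Lp ℂ 2 μ →L[ℂ] Lp ℂ 2 μ).IsSymmetric := by
  intro v w
  have hd := ContinuousMap.toLp_denseRange ℂ μ ℂ (p := 2) (by simp)
  refine hd.induction_on₂ (p := fun v w : Lp ℂ 2 μ =>
    inner ℂ (((ContinuousMap.toLp 2 μ ℂ).comp (convOp μ h)) v) w =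
      inner ℂ v (((ContinuousMap.toLp 2 μ ℂ).comp (convOp μ h)) w)) ?_ ?_ v w
  · exact isClosed_eq (by fun_prop) (by fun_prop)
  · intro f g
    rw [ContinuousLinearMap.comp_apply, ContinuousLinearMap.comp_apply, ContinuousMap.inner_toLp,
      ContinuousMap.inner_toLp]
    simp_rw [convOp_toLp hh, ← integral_conj, ← integral_const_mul, ← integral_mul_const]
    rw [integral_integral_swap_of_hasCompactSupport
      (f := fun x y => g x * (starRingEnd ℂ) (f y * h (y⁻¹ * x)))]
    · refine integral_congr_ae (Eventually.of_forall fun y =>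
        integral_congr_ae (Eventually.of_forall fun x => ?_))
      have h1 := hh (x⁻¹ * y)
      rw [mul_inv_rev, inv_inv] at h1
      simp only [map_mul]
      rw [starRingEnd_apply (h _), h1]
      ring
    · simp only [Function.uncurry_def]
      refine Continuous.mul (by fun_prop) (Complex.continuous_conj.comp ?_)
      fun_prop
    · exact HasCompactSupport.of_compactSpace _

end Convolution

/-! ### Left-finite smooth functions and the Peter–Weyl theorem -/

section LeftFinite

variable {E : Type*} [NormedAddCommGroup E] [NormedSpace ℝ E]
  {G : Type*} [Group G] [TopologicalSpace G] [ChartedSpace E G]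

variable (E) in
/-- `u` generates, under left translations, a finite-dimensional space of smooth functions, with
smoothly varying coefficients. -/
def IsSmoothLeftFinite (u : C(G, ℂ)) : Prop :=
  ∃ (n : ℕ) (φ ψ : Fin n → C(G, ℂ)), (∀ l, ContMDiff 𝓘(ℝ, E) 𝓘(ℝ, ℂ) ∞ (φ l)) ∧
    (∀ l, ContMDiff 𝓘(ℝ, E) 𝓘(ℝ, ℂ) ∞ (ψ l)) ∧ ∀ s t, u (s⁻¹ * t) = ∑ l, φ l s * ψ l t

variable [LieGroup 𝓘(ℝ, E) ∞ G]

theorem contMDiff_inv_mul_comp {h : C(G, ℂ)} (hs : ContMDiff 𝓘(ℝ, E) 𝓘(ℝ, ℂ) ∞ h) :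
    ContMDiff (𝓘(ℝ, E).prod 𝓘(ℝ, E)) 𝓘(ℝ, ℂ) ∞ fun p : G × G => h (p.1⁻¹ * p.2) :=
  hs.comp (contMDiff_fst.inv.mul contMDiff_snd)

variable [FiniteDimensional ℝ E]

variable (E) in
theorem exists_symmetric_smooth_bump [T2Space G] {U : Set G} (hU : U ∈ 𝓝 (1 : G)) :
    ∃ b : C(G, ℝ), ContMDiff 𝓘(ℝ, E) 𝓘(ℝ, ℝ) ∞ b ∧ (∀ g, 0 ≤ b g) ∧ 0 < b 1 ∧
      (∀ g ∉ U, b g = 0) ∧ ∀ g, b g⁻¹ = b g := by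
  obtain ⟨f, -, hf⟩ := ((SmoothBumpFunction.nhds_basis_tsupport (I := 𝓘(ℝ, E)) (1 : G)).mem_iff).1 hU
  -- Multiplying by the reflected bump gives invariance under inversion, which makes the convolution
  -- kernel Hermitian.
  have hs : ContMDiff 𝓘(ℝ, E) 𝓘(ℝ, ℝ) ∞ fun g => f g * f g⁻¹ :=
    f.contMDiff.mul (f.contMDiff.comp (contMDiff_inv 𝓘(ℝ, E) ∞))
  refine ⟨⟨_, hs.continuous⟩, hs, fun g => mul_nonneg f.nonneg f.nonneg, ?_, fun g hg => ?_,
    fun g => ?_⟩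
  · simp
  · have h1 : f g = 0 := image_eq_zero_of_notMem_tsupport fun h => hg (hf h)
    simp [h1]
  · simp [mul_comm]

section Measure

variable [IsTopologicalGroup G] [CompactSpace G]
  [MeasurableSpace G] [BorelSpace G] {μ : Measure G} [IsFiniteMeasure μ]

theorem contMDiff_convOp_toLp {h : C(G, ℂ)} (hs : ContMDiff 𝓘(ℝ, E) 𝓘(ℝ, ℂ) ∞ h)
    (hh : ∀ g, star (h g⁻¹) = h g) (f : C(G, ℂ)) :
    ContMDiff 𝓘(ℝ, E) 𝓘(ℝ, ℂ) ∞ (convOp μ h (ContinuousMap.toLp 2 μ ℂ f)) := by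
  have hH : ContMDiff (𝓘(ℝ, E).prod 𝓘(ℝ, E)) 𝓘(ℝ, ℂ) ∞ fun p : G × G => h (p.2⁻¹ * p.1) :=
    hs.comp (contMDiff_snd.inv.mul contMDiff_fst)
  have := contMDiff_integral μ hH continuous_id f.continuous
  refine this.congr fun x => ?_
  rw [convOp_toLp hh]
  rfl

/-- An eigenspace with nonzero eigenvalue is finite-dimensional by compactness, consists of smooth
functions because convolution smooths, and is stable under left translation. Expanding the
translates of `u` in an orthonormal basis gives the decomposition; the coefficients are smooth by
differentiation under the integral. -/
theorem isSmoothLeftFinite_convOp_of_mem_eigenspace [μ.IsMulLeftInvariant] {h : C(G, ℂ)}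
    (hs : ContMDiff 𝓘(ℝ, E) 𝓘(ℝ, ℂ) ∞ h) (hh : ∀ g, star (h g⁻¹) = h g) {c : ℂ} (hc : c ≠ 0)
    {v : Lp ℂ 2 μ} (hv : v ∈ Module.End.eigenspace
      ((ContinuousMap.toLp 2 μ ℂ).comp (convOp μ h) : Lp ℂ 2 μ →L[ℂ] Lp ℂ 2 μ).toLinearMap c) :
    IsSmoothLeftFinite E (convOp μ h v) := by
  set T : Lp ℂ 2 μ →L[ℂ] Lp ℂ 2 μ := (ContinuousMap.toLp 2 μ ℂ).comp (convOp μ h) with hT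
  set V := Module.End.eigenspace T.toLinearMap c with hV
  have hcomp : IsCompactOperator T := isCompactOperator_toLp_comp_convOp μ _
  have : FiniteDimensional ℂ V := T.finite_dimensional_eigenspace hcomp c hc
  have hmem : ∀ w, w ∈ V ↔ ContinuousMap.toLp 2 μ ℂ (convOp μ h w) = c • w := fun w =>
    Module.End.mem_eigenspace_iff
  have hw : ∀ w ∈ V, w = c⁻¹ • ContinuousMap.toLp 2 μ ℂ (convOp μ h w) := fun w hw => by
    rw [(hmem w).1 hw, smul_smul, inv_mul_cancel₀ hc, one_smul]
  have hBB : ∀ w ∈ V, convOp μ h (ContinuousMap.toLp 2 μ ℂ (convOp μ h w)) = c • convOp μ h w :=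
    fun w hw => by rw [(hmem w).1 hw, map_smul]
  have hsm : ∀ w ∈ V, ContMDiff 𝓘(ℝ, E) 𝓘(ℝ, ℂ) ∞ (convOp μ h w) := by
    intro w hwV
    have h1 : ContMDiff 𝓘(ℝ, E) 𝓘(ℝ, ℂ) ∞ fun x =>
        c⁻¹ * convOp μ h (ContinuousMap.toLp 2 μ ℂ (convOp μ h w)) x :=
      contMDiff_mul_complex contMDiff_const (contMDiff_convOp_toLp hs hh _)
    refine h1.congr fun x => ?_
    rw [hBB w hwV]
    simp [hc]
  set u := convOp μ h v with hu
  have htr : ∀ s, ContinuousMap.toLp 2 μ ℂ (leftTranslate s u) ∈ V := by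
    intro s
    have h1 : leftTranslate s (c • u) = c • leftTranslate s u := rfl
    rw [hmem, convOp_toLp_leftTranslate hh, hBB v hv, h1, map_smul]
  set b := stdOrthonormalBasis ℂ V with hb
  have hexp : ∀ s, ContinuousMap.toLp 2 μ ℂ (leftTranslate s u) =
      ∑ l, inner ℂ (b l : Lp ℂ 2 μ) (ContinuousMap.toLp 2 μ ℂ (leftTranslate s u)) •
        (b l : Lp ℂ 2 μ) := by
    intro s
    have h1 := congrArg (Subtype.val) (b.sum_repr' ⟨_, htr s⟩)
    rw [Submodule.coe_sum] at h1
    exact h1.symm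
  have hcoef : ∀ l s, inner ℂ (b l : Lp ℂ 2 μ) (ContinuousMap.toLp 2 μ ℂ (leftTranslate s u)) =
      star c⁻¹ * ∫ t, star (convOp μ h (b l) t) * u (s⁻¹ * t) ∂μ := by
    intro l s
    conv_lhs => rw [hw _ (b l).2]
    rw [inner_smul_left, ContinuousMap.inner_toLp]
    congr 1
    exact integral_congr_ae (Eventually.of_forall fun t => mul_comm _ _)
  have hφ : ∀ l, ContMDiff 𝓘(ℝ, E) 𝓘(ℝ, ℂ) ∞ fun s => c⁻¹ *
      inner ℂ (b l : Lp ℂ 2 μ) (ContinuousMap.toLp 2 μ ℂ (leftTranslate s u)) := by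
    intro l
    simp_rw [hcoef]
    refine contMDiff_mul_complex contMDiff_const (contMDiff_mul_complex contMDiff_const ?_)
    exact contMDiff_integral μ (contMDiff_inv_mul_comp (hsm v hv)) continuous_id
      (convOp μ h (b l)).continuous.star
  refine ⟨_, fun l => ⟨_, (hφ l).continuous⟩, fun l => convOp μ h (b l), hφ,
    fun l => hsm _ (b l).2, fun s t => ?_⟩
  -- Applying `convOp μ h` turns the expansion in `L²` into an identity of continuous functions,
  -- which can be evaluated at `t`.
  have h1 : c • leftTranslate s u = ∑ l,
      inner ℂ (b l : Lp ℂ 2 μ) (ContinuousMap.toLp 2 μ ℂ (leftTranslate s u)) •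
        convOp μ h (b l) := by
    have h2 := congrArg (convOp μ h) (hexp s)
    rw [map_sum, convOp_toLp_leftTranslate hh, hBB v hv] at h2
    simp_rw [map_smul] at h2
    exact h2
  have h3 := congrArg (fun f : C(G, ℂ) => c⁻¹ * f t) h1
  simp only [ContinuousMap.smul_apply, smul_eq_mul, leftTranslate_apply, ContinuousMap.sum_apply,
    inv_mul_cancel_left₀ hc] at h3
  rw [h3, Finset.mul_sum]
  exact Finset.sum_congr rfl fun l _ => (mul_assoc _ _ _).symm

end Measure

/-- **Peter–Weyl theorem**: the functions with finite-dimensional span of left translates are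
dense. -/
theorem eq_top_of_isSmoothLeftFinite_mem [IsTopologicalGroup G] [CompactSpace G] [T2Space G]
    {J : Submodule ℂ C(G, ℂ)}
    (hJ : IsClosed (J : Set C(G, ℂ))) (h : ∀ u, IsSmoothLeftFinite E u → u ∈ J) : J = ⊤ := by
  let _ : MeasurableSpace G := borel G
  have : BorelSpace G := ⟨rfl⟩
  set μ : Measure G := Measure.haar with hμ
  refine (Submodule.eq_top_iff'.2 fun w => ?_)
  set Φ : C(G, C(G, ℂ)) := ContinuousMap.curry ⟨fun p : G × G => w (p.2 * p.1), by fun_prop⟩ with hΦ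
  have hΦ1 : Φ 1 = w := by ext; simp [hΦ]
  rw [← hΦ1]
  refine mem_of_forall_integral_bump_mem μ Φ.continuous hJ 1 fun U hU => ?_
  obtain ⟨b, hbs, hb0, hb1, hbU, hbinv⟩ := exists_symmetric_smooth_bump E hU
  refine ⟨b, hb0, hb1, hbU, ?_⟩
  set k : C(G, ℂ) := ⟨fun g => (b g : ℂ), by fun_prop⟩ with hk
  have hkapp : ∀ g, k g = (b g : ℂ) := fun _ => rfl
  have hkh : ∀ g, star (k g⁻¹) = k g := fun g => by
    rw [hkapp, hkapp, hbinv]; exact Complex.conj_ofReal _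
  have hks : ContMDiff 𝓘(ℝ, E) 𝓘(ℝ, ℂ) ∞ k :=
    (Complex.ofRealCLM.contDiff.contMDiff (n := ∞)).comp hbs
  have hint : Integrable (fun y => ((b y : ℝ) : ℂ) • Φ y) μ :=
    (k.continuous.smul Φ.continuous).integrable_of_compactSpace μ
  -- Since `Φ y` is the right translate `x ↦ w (x * y)`, left invariance of `μ` and the symmetry of
  -- `b` turn this average into the convolution of `w` with `k`.
  have heq : ∫ y, ((b y : ℝ) : ℂ) • Φ y ∂μ = convOp μ k (ContinuousMap.toLp 2 μ ℂ w) := by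
    ext x
    rw [convOp_toLp hkh]
    have h1 := (ContinuousMap.evalCLM ℂ x).integral_comp_comm hint
    rw [ContinuousMap.evalCLM_apply] at h1
    rw [← h1, ← integral_mul_left_eq_self (fun y => w y * k (y⁻¹ * x)) x]
    refine integral_congr_ae (Eventually.of_forall fun y => ?_)
    simp [hΦ, hkapp, hbinv, mul_comm]
  rw [heq]
  set T : Lp ℂ 2 μ →L[ℂ] Lp ℂ 2 μ := (ContinuousMap.toLp 2 μ ℂ).comp (convOp μ k) with hT
  have hcomp : IsCompactOperator T := isCompactOperator_toLp_comp_convOp μ _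
  have hbot := ContinuousLinearMap.orthogonalComplement_iSup_eigenspaces_eq_bot hcomp
    (isSymmetric_toLp_comp_convOp μ hkh)
  set J' : Submodule ℂ (Lp ℂ 2 μ) := J.comap (convOp μ k).toLinearMap with hJ'
  have hJ'c : IsClosed (J' : Set (Lp ℂ 2 μ)) := hJ.preimage (convOp μ k).continuous
  have hle : ⨆ c, Module.End.eigenspace T.toLinearMap c ≤ J' := by
    refine iSup_le fun c v hv => ?_
    rw [hJ', Submodule.mem_comap]
    by_cases hc : c = 0
    -- The kernel contributes nothing: Haar measure has full support, so a continuous function that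
    -- is zero in `L²` is zero.
    · have h1 : ContinuousMap.toLp 2 μ ℂ (convOp μ k v) = 0 := by
        have h2 := Module.End.mem_eigenspace_iff.1 hv
        rw [hc, zero_smul] at h2
        exact h2
      have h3 : convOp μ k v = 0 := ContinuousMap.toLp_injective (𝕜 := ℂ) (p := 2) μ (by rw [h1, map_zero])
      change convOp μ k v ∈ J
      rw [h3]
      exact J.zero_mem
    · exact h _ (isSmoothLeftFinite_convOp_of_mem_eigenspace hks hkh hc hv)
  have htop : J' = ⊤ := by
    rw [← Submodule.topologicalClosure_eq_top_iff] at hbot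
    rw [eq_top_iff, ← hbot]
    exact Submodule.topologicalClosure_minimal _ hle hJ'c
  have hmem : ContinuousMap.toLp 2 μ ℂ w ∈ J' := htop ▸ Submodule.mem_top
  exact hmem

end LeftFinite

/-! ### Local sections of submersions and descent of smoothness -/

section Submersion

variable {E : Type*} [NormedAddCommGroup E] [NormedSpace ℝ E]
  {M : Type*} [TopologicalSpace M] [ChartedSpace E M]
  {F : Type*} [NormedAddCommGroup F] [NormedSpace ℝ F]
  {N : Type*} [TopologicalSpace N] [ChartedSpace F N]

/-- A submersion has smooth local sections. -/
theorem exists_local_section_of_isSubmersionAt [IsManifold 𝓘(ℝ, E) ∞ M] [IsManifold 𝓘(ℝ, F) ∞ N]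
    {π : M → N} {x : M} (h : Manifold.IsSubmersionAt 𝓘(ℝ, E) 𝓘(ℝ, F) ∞ π x) :
    ∃ σ : N → M, ContMDiffAt 𝓘(ℝ, F) 𝓘(ℝ, E) ∞ σ (π x) ∧ ∀ᶠ z in 𝓝 (π x), π (σ z) = z := by
  set d := h.domChart with hd
  set c := h.codChart with hc
  set e := h.equiv with he
  have hx : x ∈ d.source := h.mem_domChart_source
  have hπx : π x ∈ c.source := h.mem_codChart_source
  have hwr : ∀ w ∈ d.target, c (π (d.symm w)) = (e w).1 := by
    intro w hw
    have hw' : w ∈ (d.extend 𝓘(ℝ, E)).target := by simpa using hw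
    simpa using h.writtenInCharts hw'
  -- In submersion charts the map is a linear projection; the section freezes the complementary
  -- coordinate at its value at `x`.
  set τ : N → E := fun z => e.symm (c z, (e (d x)).2) with hτ
  have hτx : τ (π x) = d x := by
    have h1 := hwr (d x) (d.map_source hx)
    rw [d.left_inv hx] at h1
    simp only [hτ]
    rw [h1, Prod.mk.eta, e.symm_apply_apply]
  have hτs : ContMDiffAt 𝓘(ℝ, F) 𝓘(ℝ, E) ∞ τ (π x) := by
    have h1 : ContMDiffAt 𝓘(ℝ, F) 𝓘(ℝ, F) ∞ c (π x) :=
      contMDiffAt_of_mem_maximalAtlas h.codChart_mem_maximalAtlas hπx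
    have h2 : ContDiff ℝ ∞ fun y : F => e.symm (y, (e (d x)).2) := by fun_prop
    exact h2.contMDiff.contMDiffAt.comp (π x) h1
  have hds : ContMDiffAt 𝓘(ℝ, E) 𝓘(ℝ, E) ∞ d.symm (τ (π x)) :=
    contMDiffAt_symm_of_mem_maximalAtlas h.domChart_mem_maximalAtlas
      (hτx ▸ d.map_source hx)
  refine ⟨fun z => d.symm (τ z), hds.comp (π x) hτs, ?_⟩
  have h1 : ∀ᶠ z in 𝓝 (π x), τ z ∈ d.target :=
    hτs.continuousAt.eventually_mem (d.open_target.mem_nhds (hτx ▸ d.map_source hx))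
  filter_upwards [h1, c.open_source.mem_nhds hπx] with z hz hzc
  have h2 : d.symm (τ z) ∈ d.source := d.map_target hz
  refine c.injOn (h.source_subset_preimage_source h2) hzc ?_
  rw [hwr _ hz]
  simp [hτ]

/-- A function on the base of a surjective submersion is smooth if its pullback is. -/
theorem contMDiff_of_comp_isSubmersion [IsManifold 𝓘(ℝ, E) ∞ M] [IsManifold 𝓘(ℝ, F) ∞ N]
    {π : M → N} (hπ : Manifold.IsSubmersion 𝓘(ℝ, E) 𝓘(ℝ, F) ∞ π) (hsurj : Function.Surjective π)
    {f : N → ℂ} (hf : ContMDiff 𝓘(ℝ, E) 𝓘(ℝ, ℂ) ∞ (f ∘ π)) : ContMDiff 𝓘(ℝ, F) 𝓘(ℝ, ℂ) ∞ f := by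
  intro z
  obtain ⟨x, rfl⟩ := hsurj z
  obtain ⟨C, i1, i2, h⟩ := hπ
  obtain ⟨σ, hσ, hπσ⟩ := exists_local_section_of_isSubmersionAt (h x).isSubmersionAt
  refine (ContMDiffAt.comp (π x) (hf (σ (π x))) hσ).congr_of_eventuallyEq ?_
  filter_upwards [hπσ] with z hz
  simp [hz]

end Submersion

/-! ### Continuity of point evaluations -/

section Evaluation

variable {A : Type*} [NonUnitalNormedCommRing A] [NormedSpace ℂ A]
    [CompleteSpace A] {X : Type*} [TopologicalSpace X] (ι : A →ₙₐ[ℂ] C(X, ℂ))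

/-- Characters of a Banach algebra are contractive. -/
theorem norm_apply_le (x : X) (a : A) : ‖ι a x‖ ≤ ‖a‖ := by
  by_contra! hlt
  have hne : ι a x ≠ 0 := fun h => by
    rw [h, norm_zero] at hlt
    exact absurd hlt (norm_nonneg a).not_gt
  set a' := (ι a x)⁻¹ • a with ha'
  have h1 : ι a' x = 1 := by simp [ha', hne]
  have hnorm : ‖a'‖₊ < 1 := by
    rw [← NNReal.coe_lt_coe, coe_nnnorm, ha', norm_smul, norm_inv, NNReal.coe_one,
      inv_mul_lt_one₀ (norm_pos_iff.2 hne)]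
    exact hlt
  -- A fixed point `b = a' + a' * b` would give `ι b x = 1 + ι b x`. This replaces inverting `1 -
  -- a'`, as `A` need not have a unit.
  have hcontr : ContractingWith ‖a'‖₊ fun b => a' + a' * b := by
    refine ⟨hnorm, LipschitzWith.of_dist_le_mul fun b c => ?_⟩
    rw [dist_add_left, dist_eq_norm, dist_eq_norm, ← mul_sub]
    exact norm_mul_le _ _
  obtain ⟨b, hb, -⟩ := hcontr.exists_fixedPoint 0 (edist_ne_top _ _)
  have h2 := congrArg (fun b => ι b x) (show a' + a' * b = b from hb)
  simp only [map_add, map_mul, ContinuousMap.add_apply, ContinuousMap.mul_apply, h1, one_mul] at h2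
  exact one_ne_zero (add_eq_right.1 h2)

/-- Evaluation at a point as a continuous functional on a Banach algebra of functions. -/
def evalL (x : X) : A →L[ℂ] ℂ :=
  LinearMap.mkContinuous
    { toFun := fun a => ι a x
      map_add' := fun a b => by simp
      map_smul' := fun c a => by simp } 1 fun a => by simpa using norm_apply_le ι x a

@[simp]
theorem evalL_apply (x : X) (a : A) : evalL ι x a = ι a x := rfl

end Evaluation

theorem smoothVanishing_subset_vanishing {A : Type*} [NonUnitalNormedCommRing A] [NormedSpace ℂ A]
    {X : Type*} [TopologicalSpace X]
    {V : Type*} [NormedAddCommGroup V] [NormedSpace ℝ V] [ChartedSpace V X]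
    (ι : A →ₙₐ[ℂ] C(X, ℂ)) (hι : ∀ x, Continuous fun a => ι a x) (S : Set X) :
    smoothVanishing V ι S ⊆ vanishing ι S := by
  refine closure_minimal (fun a ha => ha.2) ?_
  have : vanishing ι S = ⋂ x ∈ S, {a | ι a x = 0} := by
    ext a
    simp [vanishing]
  rw [this]
  exact isClosed_biInter fun x _ => isClosed_eq (hι x) continuous_const

/-! ### Averages of right translates over `K` -/

section Averaging

variable {A : Type*} [NonUnitalNormedCommRing A] [NormedSpace ℂ A]
  {G : Type*} [Group G] [TopologicalSpace G] {ι : A →ₙₐ[ℂ] C(G, ℂ)}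

/-- The right translate `R_s a`. -/
def translate (hinv : IsRightInvariant ι) (s : G) (a : A) : A := (hinv.exists_translate s a).choose

theorem apply_translate (hinv : IsRightInvariant ι) (s : G) (a : A) (y : G) :
    ι (translate hinv s a) y = ι a (y * s) :=
  (hinv.exists_translate s a).choose_spec y

theorem norm_translate (hinv : IsRightInvariant ι) (s : G) (a : A) : ‖translate hinv s a‖ = ‖a‖ :=
  hinv.norm_translate s a _ (apply_translate hinv s a)

theorem continuous_translate (hinv : IsRightInvariant ι) (a : A) :
    Continuous fun s => translate hinv s a :=
  hinv.continuous_translate a _ fun s => apply_translate hinv s a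

theorem translate_add (hι : Function.Injective ι) (hinv : IsRightInvariant ι) (s : G) (a b : A) :
    translate hinv s (a + b) = translate hinv s a + translate hinv s b :=
  hι (ContinuousMap.ext fun y => by simp [apply_translate])

theorem translate_smul (hι : Function.Injective ι) (hinv : IsRightInvariant ι) (s : G) (c : ℂ)
    (a : A) : translate hinv s (c • a) = c • translate hinv s a :=
  hι (ContinuousMap.ext fun y => by simp [apply_translate])

theorem translate_one (hι : Function.Injective ι) (hinv : IsRightInvariant ι) (a : A) :
    translate hinv 1 a = a :=
  hι (ContinuousMap.ext fun y => by simp [apply_translate])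

theorem norm_integral_smul_translate_le [CompactSpace G] {K : Subgroup G} [MeasurableSpace K]
    (ν : Measure K) [IsProbabilityMeasure ν] (hinv : IsRightInvariant ι) (w : C(G, ℂ)) (a : A) :
    ‖∫ k : K, w k • translate hinv (k : G) a ∂ν‖ ≤ ‖w‖ * ‖a‖ := by
  refine (norm_integral_le_of_norm_le_const (C := ‖w‖ * ‖a‖) (Eventually.of_forall fun k => ?_)).trans
    (by simp)
  rw [norm_smul, norm_translate]
  exact mul_le_mul_of_nonneg_right (w.norm_coe_le_norm _) (norm_nonneg a)

variable {K : Subgroup G} [CompactSpace K] [MeasurableSpace K] [BorelSpace K]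
  (ν : Measure K) [IsProbabilityMeasure ν]

theorem integrable_smul_translate (hinv : IsRightInvariant ι) (w : C(G, ℂ)) (a : A) :
    Integrable (fun k : K => w k • translate hinv (k : G) a) ν := by
  have h1 : Continuous fun k : K => translate hinv (k : G) a :=
    (continuous_translate hinv a).comp continuous_subtype_val
  have h2 : Continuous fun k : K => w k := w.continuous.comp continuous_subtype_val
  exact (h2.smul h1).integrable_of_compactSpace ν

variable [CompactSpace G]

/-- The bounded operator `w ↦ ∫_K w(k) R_k a dk`. -/
def weightedAverage (hinv : IsRightInvariant ι) (a : A) : C(G, ℂ) →L[ℂ] A :=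
  LinearMap.mkContinuous
    { toFun := fun w => ∫ k : K, w k • translate hinv (k : G) a ∂ν
      map_add' := fun v w => by
        rw [← integral_add (integrable_smul_translate ν hinv v a)
          (integrable_smul_translate ν hinv w a)]
        simp [add_smul]
      map_smul' := fun c w => by
        rw [RingHom.id_apply, ← integral_smul]
        simp [mul_smul] } ‖a‖ fun w => by
    rw [mul_comm]
    exact norm_integral_smul_translate_le ν hinv w a

theorem weightedAverage_apply (hinv : IsRightInvariant ι) (a : A) (w : C(G, ℂ)) :
    weightedAverage ν hinv a w = ∫ k : K, w k • translate hinv (k : G) a ∂ν := rfl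

/-- The averaging operator `a ↦ ∫_K R_k a dk`. -/
def average (hι : Function.Injective ι) (hinv : IsRightInvariant ι) : A →L[ℂ] A :=
  LinearMap.mkContinuous
    { toFun := fun a => weightedAverage ν hinv a 1
      map_add' := fun a b => by
        simp only [weightedAverage_apply, translate_add hι, smul_add]
        exact integral_add (integrable_smul_translate ν hinv 1 a)
          (integrable_smul_translate ν hinv 1 b)
      map_smul' := fun c a => by
        rw [RingHom.id_apply, weightedAverage_apply, weightedAverage_apply, ← integral_smul]
        simp [translate_smul hι] } ‖(1 : C(G, ℂ))‖ fun a =>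
    norm_integral_smul_translate_le ν hinv 1 a

theorem average_apply (hι : Function.Injective ι) (hinv : IsRightInvariant ι) (a : A) :
    average ν hι hinv a = weightedAverage ν hinv a 1 := rfl

variable [CompleteSpace A]

theorem apply_weightedAverage (hinv : IsRightInvariant ι) (a : A) (w : C(G, ℂ)) (s : G) :
    ι (weightedAverage ν hinv a w) s = ∫ k : K, w k * ι a (s * k) ∂ν := by
  have h1 := (evalL ι s).integral_comp_comm (integrable_smul_translate ν hinv w a)
  rw [weightedAverage_apply, ← evalL_apply, ← h1]
  refine integral_congr_ae (Eventually.of_forall fun k => ?_)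
  simp [apply_translate]

theorem apply_average (hι : Function.Injective ι) (hinv : IsRightInvariant ι) (a : A) (s : G) :
    ι (average ν hι hinv a) s = ∫ k : K, ι a (s * k) ∂ν := by
  rw [average_apply, apply_weightedAverage]
  simp

theorem average_mem_invariants [IsTopologicalGroup G] [ν.IsMulLeftInvariant]
    (hι : Function.Injective ι) (hinv : IsRightInvariant ι) (a : A) :
    average ν hι hinv a ∈ invariants ι K := by
  intro k hk y
  rw [apply_average, apply_average,
    ← integral_mul_left_eq_self (fun l : K => ι a (y * l)) (⟨k, hk⟩ : K)]
  simp [mul_assoc]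

theorem average_eq_self (hι : Function.Injective ι) (hinv : IsRightInvariant ι) {a : A}
    (ha : a ∈ invariants ι K) : average ν hι hinv a = a := by
  refine hι (ContinuousMap.ext fun s => ?_)
  rw [apply_average]
  have h1 : ∀ k : K, ι a (s * k) = ι a s := fun k => (ha k k.2 s).symm
  simp [h1]

theorem average_mem_vanishing (hι : Function.Injective ι) (hinv : IsRightInvariant ι)
    {S : Set (G ⧸ K)} {a : A} (ha : ∀ s : G, (s : G ⧸ K) ∈ S → ι a s = 0) {s : G}
    (hs : (s : G ⧸ K) ∈ S) : ι (average ν hι hinv a) s = 0 := by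
  rw [apply_average]
  have h1 : ∀ k : K, ι a (s * k) = 0 := fun k => by
    refine ha _ ?_
    rwa [QuotientGroup.mk_mul_of_mem s k.2]
  simp [h1]

theorem contMDiff_average {E : Type*} [NormedAddCommGroup E] [NormedSpace ℝ E]
    [FiniteDimensional ℝ E] [ChartedSpace E G] [LieGroup 𝓘(ℝ, E) ∞ G]
    (hι : Function.Injective ι) (hinv : IsRightInvariant ι) {a : A}
    (ha : ContMDiff 𝓘(ℝ, E) 𝓘(ℝ, ℂ) ∞ (ι a)) :
    ContMDiff 𝓘(ℝ, E) 𝓘(ℝ, ℂ) ∞ (ι (average ν hι hinv a)) := by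
  have hH : ContMDiff (𝓘(ℝ, E).prod 𝓘(ℝ, E)) 𝓘(ℝ, ℂ) ∞ fun p : G × G => ι a (p.1 * p.2) :=
    ha.comp (contMDiff_fst.mul contMDiff_snd)
  refine (contMDiff_integral ν hH continuous_subtype_val (continuous_const (y := (1 : ℂ)))).congr
    fun s => ?_
  simp [apply_average]

/-- A weighted average, with a weight that generates a finite-dimensional space of functions, is a
combination of averages. -/
theorem weightedAverage_eq_sum (hι : Function.Injective ι) (hinv : IsRightInvariant ι) (a : A)
    {u : C(G, ℂ)} {n : ℕ} {φ ψ : Fin n → A}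
    (hu : ∀ s t, u (s⁻¹ * t) = ∑ l, ι (φ l) s * ι (ψ l) t) :
    weightedAverage ν hinv a u = ∑ l, φ l * average ν hι hinv (ψ l * a) := by
  refine hι (ContinuousMap.ext fun s => ?_)
  have h0 : Continuous fun k : K => (k : G) := continuous_subtype_val
  rw [apply_weightedAverage, map_sum, ContinuousMap.sum_apply]
  simp_rw [map_mul, ContinuousMap.mul_apply, apply_average, ← integral_const_mul]
  have hcont : ∀ b : A, Continuous fun k : K => ι b (s * k) := fun b => by
    have h1 : Continuous fun k : K => translate hinv (k : G) b :=
      (continuous_translate hinv b).comp h0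
    refine ((evalL ι s).continuous.comp h1).congr fun k => ?_
    simp [apply_translate]
  rw [← integral_finsetSum]
  · refine integral_congr_ae (Eventually.of_forall fun k => ?_)
    -- Taking `t = s * k` expresses `u k` through `φ l` at `s` and `ψ l` at `s * k`; the former is
    -- constant in `k` and leaves the integral.
    have h1 := hu s (s * k)
    rw [inv_mul_cancel_left] at h1
    simp only [h1, Finset.sum_mul, map_mul, ContinuousMap.mul_apply, mul_assoc]
  · exact fun l _ => (continuous_const.mul (hcont _)).integrable_of_compactSpace ν

end Averaging

section Synthesis

variable {A : Type*} [NonUnitalNormedCommRing A] [NormedSpace ℂ A]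
  {X : Type*} [TopologicalSpace X]
  {V : Type*} [NormedAddCommGroup V] [NormedSpace ℝ V] [ChartedSpace V X]

theorem mem_testFunctions_iff [CompactSpace X] {f : C(X, ℂ)} :
    f ∈ testFunctions X V ↔ ContMDiff 𝓘(ℝ, V) 𝓘(ℝ, ℂ) ∞ f :=
  and_iff_left (HasCompactSupport.of_compactSpace _)

variable (V) in
/-- The smooth elements of `A` that vanish on `S`. -/
def smoothVanishingSubmodule [CompactSpace X] (ι : A →ₙₐ[ℂ] C(X, ℂ)) (S : Set X) :
    Submodule ℂ A where
  carrier := {a | ι a ∈ testFunctions X V ∧ ∀ x ∈ S, ι a x = 0}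
  add_mem' {a b} ha hb := by
    refine ⟨mem_testFunctions_iff.2 ?_, fun x hx => by simp [ha.2 x hx, hb.2 x hx]⟩
    rw [map_add]
    exact (mem_testFunctions_iff.1 ha.1).add (mem_testFunctions_iff.1 hb.1)
  zero_mem' := by
    refine ⟨mem_testFunctions_iff.2 ?_, fun x _ => by simp⟩
    rw [map_zero]
    exact contMDiff_const
  smul_mem' c a ha := by
    refine ⟨mem_testFunctions_iff.2 ?_, fun x hx => by simp [ha.2 x hx]⟩
    rw [map_smul]
    exact contMDiff_mul_complex contMDiff_const (mem_testFunctions_iff.1 ha.1)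

end Synthesis

/-! ### Transfer of smooth synthesis between `G` and `G ⧸ K` -/

section Quotient

variable {E : Type*} [NormedAddCommGroup E] [NormedSpace ℝ E] [FiniteDimensional ℝ E]
  {G : Type*} [Group G] [TopologicalSpace G] [IsTopologicalGroup G] [CompactSpace G]
  [ChartedSpace E G] [LieGroup 𝓘(ℝ, E) ∞ G]
  {K : Subgroup G} [CompactSpace K]
  {F : Type*} [NormedAddCommGroup F] [NormedSpace ℝ F]
  [ChartedSpace F (G ⧸ K)]
  (hπ : Manifold.IsSubmersion 𝓘(ℝ, E) 𝓘(ℝ, F) ∞ (QuotientGroup.mk : G → G ⧸ K))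
  {A : Type*} [NonUnitalNormedCommRing A] [NormedSpace ℂ A] [CompleteSpace A]
  {ι : A →ₙₐ[ℂ] C(G, ℂ)} (hι : Function.Injective ι) (hinv : IsRightInvariant ι)
  {S : Set (G ⧸ K)}

include hπ hι hinv

/-- Smooth synthesis descends from the preimage in `G` to a subset of `G ⧸ K`, by averaging over
`K`. -/
theorem IsSmoothSynthesis.cosetInclusion [IsManifold 𝓘(ℝ, F) ∞ (G ⧸ K)]
    (h : IsSmoothSynthesis E ι {s : G | (QuotientGroup.mk s : G ⧸ K) ∈ S}) :
    IsSmoothSynthesis F (SmoothSynthesis.cosetInclusion ι K) S := by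
  refine (smoothVanishing_subset_vanishing _ (fun x => ?_) S).antisymm fun a ha => ?_
  · induction x using QuotientGroup.induction_on with
    | H s => exact (evalL ι s).continuous.comp continuous_subtype_val
  let _ : MeasurableSpace K := borel K
  have : BorelSpace K := ⟨rfl⟩
  set ν : Measure K := Measure.haarMeasure ⊤
  have : IsProbabilityMeasure ν := ⟨Measure.haarMeasure_self⟩
  have ha' : (a : A) ∈ smoothVanishing E ι {s : G | (QuotientGroup.mk s : G ⧸ K) ∈ S} := by
    rw [h]
    exact fun s hs => ha _ hs
  -- Averaging is a continuous retraction onto `A(G:K)`, so it carries an approximation of `a` by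
  -- smooth elements of `A` to one inside `A(G:K)`.
  let P : A → invariants ι K := fun b =>
    ⟨average ν hι hinv b, average_mem_invariants ν hι hinv b⟩
  have hP : Continuous P := (average ν hι hinv).continuous.subtype_mk _
  have hPa : P a = a := Subtype.ext (average_eq_self ν hι hinv a.2)
  rw [← hPa]
  refine map_mem_closure hP ha' fun b hb => ⟨mem_testFunctions_iff.2 ?_, fun x hx => ?_⟩
  · exact contMDiff_of_comp_isSubmersion hπ QuotientGroup.mk_surjective
      (contMDiff_average ν hι hinv (mem_testFunctions_iff.1 hb.1))
  · induction x using QuotientGroup.induction_on with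
    | H s => exact average_mem_vanishing ν hι hinv (fun s hs => hb.2 s hs) hx

/-- Smooth synthesis lifts from a subset of `G ⧸ K` to its preimage in `G`. -/
theorem IsSmoothSynthesis.preimage_mk [T2Space G]
    (hsmooth : ∀ f ∈ testFunctions G E, ∃ a : A, ι a = f)
    (h : IsSmoothSynthesis F (SmoothSynthesis.cosetInclusion ι K) S) :
    IsSmoothSynthesis E ι {s : G | (QuotientGroup.mk s : G ⧸ K) ∈ S} := by
  refine (smoothVanishing_subset_vanishing _
    (fun s => (evalL ι s).continuous) _).antisymm fun a ha => ?_
  let _ : MeasurableSpace K := borel K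
  have : BorelSpace K := ⟨rfl⟩
  set ν : Measure K := Measure.haarMeasure ⊤
  have : IsProbabilityMeasure ν := ⟨Measure.haarMeasure_self⟩
  set J := (smoothVanishingSubmodule E ι
    {s : G | (QuotientGroup.mk s : G ⧸ K) ∈ S}).topologicalClosure with hJdef
  have hJ : IsClosed (J : Set A) := Submodule.isClosed_topologicalClosure _
  have hsm : ContMDiff 𝓘(ℝ, E) 𝓘(ℝ, F) ∞ (QuotientGroup.mk : G → G ⧸ K) := by
    obtain ⟨C, i1, i2, hC⟩ := hπ
    exact fun s => (hC s).contMDiffAt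
  -- Synthesis on `G ⧸ K` enters here: `b` is a limit of elements smooth on `G ⧸ K`, whose pullbacks
  -- to `G` stay smooth after multiplication by `φ`.
  have hmul : ∀ φ : A, ContMDiff 𝓘(ℝ, E) 𝓘(ℝ, ℂ) ∞ (ι φ) → ∀ b : invariants ι K,
      b ∈ vanishing (SmoothSynthesis.cosetInclusion ι K) S → φ * (b : A) ∈ J := by
    intro φ hφ b hb
    rw [← h] at hb
    have hcont : Continuous fun b : invariants ι K => φ * (b : A) :=
      continuous_const.mul continuous_subtype_val
    refine map_mem_closure (f := fun b : invariants ι K => φ * (b : A)) hcont hb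
      fun c hc => ⟨mem_testFunctions_iff.2 ?_, fun s hs => ?_⟩
    · rw [map_mul]
      exact contMDiff_mul_complex hφ ((mem_testFunctions_iff.1 hc.1).comp hsm)
    · have h1 : ι (c : A) s = 0 := hc.2 _ hs
      simp [h1]
  -- Peter–Weyl is applied on `G` rather than `K`, so that the factors `φ l` and `ψ l` are smooth on
  -- `G` and hence lie in `A`.
  have htop : J.comap (weightedAverage ν hinv a).toLinearMap = ⊤ := by
    refine eq_top_of_isSmoothLeftFinite_mem (E := E)
      (hJ.preimage (weightedAverage ν hinv a).continuous) fun u hu => ?_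
    obtain ⟨n, φ, ψ, hφ, hψ, hu⟩ := hu
    choose φ' hφ' using fun l => hsmooth (φ l) (mem_testFunctions_iff.2 (hφ l))
    choose ψ' hψ' using fun l => hsmooth (ψ l) (mem_testFunctions_iff.2 (hψ l))
    have h1 := weightedAverage_eq_sum ν hι hinv a (u := u) (φ := φ') (ψ := ψ')
      (by simpa only [hφ', hψ'] using hu)
    change weightedAverage ν hinv a u ∈ J
    rw [h1]
    refine Submodule.sum_mem _ fun l _ => ?_
    refine hmul (φ' l) (by rw [hφ']; exact hφ l)
      ⟨_, average_mem_invariants ν hι hinv (ψ' l * a)⟩ fun x hx => ?_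
    induction x using QuotientGroup.induction_on with
    | H s =>
      refine average_mem_vanishing ν hι hinv (S := S) (fun t ht => ?_) hx
      have h2 : ι a t = 0 := ha t ht
      simp [h2]
  -- Bumps on `G` at `1`, restricted to `K`, concentrate at `1 : K`, so the averages in `J` converge
  -- to `R_1 a = a`.
  have hmem : translate hinv ((1 : K) : G) a ∈ J := by
    refine mem_of_forall_integral_bump_mem ν
      ((continuous_translate hinv a).comp continuous_subtype_val) hJ (1 : K) fun U hU => ?_
    obtain ⟨U', hU', hUU'⟩ := mem_nhds_subtype _ _ _ |>.1 hU
    obtain ⟨b, -, hb0, hb1, hbU, -⟩ := exists_symmetric_smooth_bump E hU'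
    refine ⟨⟨fun k => b k, by fun_prop⟩, fun k => hb0 k, hb1, fun k hk => hbU k fun hk' =>
      hk (hUU' hk'), ?_⟩
    have h1 : (⟨fun g => (b g : ℂ), by fun_prop⟩ : C(G, ℂ)) ∈
        J.comap (weightedAverage ν hinv a).toLinearMap := htop ▸ Submodule.mem_top
    exact h1
  rw [OneMemClass.coe_one, translate_one hι] at hmem
  exact hmem

end Quotient

end SmoothSynthesis
end

theorem theoremT
    -- a compact Lie group `G`
    {E : Type*} [NormedAddCommGroup E] [NormedSpace ℝ E] [FiniteDimensional ℝ E]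
    {G : Type*} [Group G] [TopologicalSpace G] [T2Space G] [CompactSpace G]
    [ChartedSpace E G] [LieGroup 𝓘(ℝ, E) ∞ G]
    -- a compact subgroup `K`, with the smooth structure on `G ⧸ K` (over its quotient topology)
    -- for which the projection is a submersion
    (K : Subgroup G) (hK : IsCompact (K : Set G))
    {F : Type*} [NormedAddCommGroup F] [NormedSpace ℝ F] [FiniteDimensional ℝ F]
    [ChartedSpace F (G ⧸ K)] [IsManifold 𝓘(ℝ, F) ∞ (G ⧸ K)]
    (hπ : Manifold.IsSubmersion 𝓘(ℝ, E) 𝓘(ℝ, F) ∞ (QuotientGroup.mk : G → G ⧸ K))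
    -- a Banach algebra `A` of continuous functions on `G`, with inclusion `ι`
    {A : Type*} [NonUnitalNormedCommRing A] [NormedSpace ℂ A] [IsScalarTower ℂ A A]
    [SMulCommClass ℂ A A] [CompleteSpace A]
    (ι : A →ₙₐ[ℂ] C(G, ℂ)) (hι : Function.Injective ι)
    (hreg : SmoothSynthesis.IsRegularOn ι)
    (hinv : SmoothSynthesis.IsRightInvariant ι)
    -- `T(G) A ⊆ A`
    (htrig : ∀ u ∈ SmoothSynthesis.trigPolynomials G, ∀ a : A, ∃ b : A, ι b = u * ι a)
    -- `D(G) ⊆ A`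
    (hsmooth : ∀ f ∈ SmoothSynthesis.testFunctions G E, ∃ a : A, ι a = f)
    (S : Set (G ⧸ K)) (hS : IsClosed S) :
    SmoothSynthesis.IsSmoothSynthesis F (SmoothSynthesis.cosetInclusion ι K) S ↔
      SmoothSynthesis.IsSmoothSynthesis E ι {s : G | (QuotientGroup.mk s : G ⧸ K) ∈ S} := by
  have : IsTopologicalGroup G := topologicalGroup_of_lieGroup 𝓘(ℝ, E) ∞
  have : CompactSpace K := isCompact_iff_compactSpace.1 hK
  exact ⟨SmoothSynthesis.IsSmoothSynthesis.preimage_mk hπ hι hinv hsmooth,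
    SmoothSynthesis.IsSmoothSynthesis.cosetInclusion hπ hι hinv⟩
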